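/- Let $S\subset\mathbb{R}^3$ be a set of $n$ points in convex position (no point of $S$ lies in the convex hull of the others) and in general position (any at most four points of $S$ are affinely independent), and let $\kappa\colon S\to K$ be a coloring with a set $K$ of $m$ colors, each of which is used by at least one point. Consider oriented triangles $\sigma$ with vertex set $D_\sigma\subseteq S$, $|D_\sigma|=3$, where the orientation selects one of the two open half-spaces bounded by the plane through $D_\sigma$, denoted $\sigma^+$. Such a $\sigma$ is a *$c$-chromatic colored $j$-facet* if $|\kappa(D_\sigma)|=c$, exactly $j$ colors occur among the points of $S\cap\sigma^+$, and none of these colors belongs to $\kappa(D_\sigma)$. Let $e_{c,j}$ be the number of $c$-chromatic colored $j$-facets. Then for every integer $0\le j\le m-2$, $$e_{3,j}+\sum_{i=0}^{j}e_{2,i}+\sum_{i=0}^{j}(j-i+1)\,e_{1,i}=2(j+1)(n-j-2).$$ In particular, if $m=n$, then for every $0\le j\le n-2$ the number $e_j=e_{1,j}+e_{2,j}+e_{3,j}$ equals $2(j+1)(n-j-2)$, and so does the number of uncolored $j$-facets of $S$, that is, of oriented triangles $\sigma$ with vertices in $S$ such that $\sigma^+$ contains exactly $j$ points of $S$. -/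

import Mathlib

namespace ColoredFacets

/-- A finite point set in `ℝ^d` is in general position if any at most `d + 1` of its points are
affinely independent (for `d = 3`: no three collinear, no four coplanar). -/
def InGeneralPosition {d : ℕ} (S : Finset (EuclideanSpace ℝ (Fin d))) : Prop :=
  ∀ T : Finset (EuclideanSpace ℝ (Fin d)), T ⊆ S → T.card ≤ d + 1 →
    AffineIndependent ℝ ((↑) : T → EuclideanSpace ℝ (Fin d))

/-- A finite point set is in convex position if none of its points lies in the convex hull of
the others. -/
def InConvexPosition {d : ℕ} (S : Finset (EuclideanSpace ℝ (Fin d))) : Prop :=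
  ConvexIndependent ℝ ((↑) : S → EuclideanSpace ℝ (Fin d))

/-- An oriented `(d-1)`-simplex in `ℝ^d`: `d` affinely independent vertices, together with
the orientation, given as the choice of one of the two open half-spaces
bounded by the hyperplane through the vertices (the positive side of the simplex). -/
@[ext]
structure OrientedSimplex (d : ℕ) where
  /-- the vertices -/
  verts : Finset (EuclideanSpace ℝ (Fin d))
  card_verts : verts.card = d
  affineIndependent : AffineIndependent ℝ ((↑) : verts → EuclideanSpace ℝ (Fin d))
  /-- the open half-space on the positive side -/
  posSide : Set (EuclideanSpace ℝ (Fin d))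
  isHalfSpace : ∃ (f : EuclideanSpace ℝ (Fin d) →ₗ[ℝ] ℝ) (a : ℝ), f ≠ 0 ∧
    (∀ p ∈ verts, f p = a) ∧ posSide = {x | a < f x}

/-- The (uncolored) `j`-facets in `S`. -/
def facets {d : ℕ} (S : Finset (EuclideanSpace ℝ (Fin d))) (j : ℕ) : Set (OrientedSimplex d) :=
  {σ | σ.verts ⊆ S ∧ {s | s ∈ S ∧ s ∈ σ.posSide}.ncard = j}

variable {d : ℕ} {K : Type*} {S : Finset (EuclideanSpace ℝ (Fin d))}

/-- The set of colors intersected by `A`, i.e. the colors of the points of `S` in `A`. -/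
def colorsOf (κ : S → K) (A : Set (EuclideanSpace ℝ (Fin d))) : Set K :=
  {i | ∃ s : S, (s : EuclideanSpace ℝ (Fin d)) ∈ A ∧ κ s = i}

/-- The `c`-chromatic colored `j`-facets in `S` with respect to the coloring `κ`: simplices with
vertices in `S`, the vertices having exactly `c` colors, whose positive side intersects
exactly `j` colors, none of which is a color of a vertex. -/
def chromaticFacets (κ : S → K) (c j : ℕ) : Set (OrientedSimplex d) :=
  {σ | σ.verts ⊆ S ∧
    Disjoint (colorsOf κ σ.posSide) (colorsOf κ (σ.verts : Set (EuclideanSpace ℝ (Fin d)))) ∧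
    (colorsOf κ σ.posSide).ncard = j ∧
    (colorsOf κ (σ.verts : Set (EuclideanSpace ℝ (Fin d)))).ncard = c}

/-- `e_{c,j}`: the number of `c`-chromatic colored `j`-facets. -/
noncomputable def e (κ : S → K) (c j : ℕ) : ℕ := (chromaticFacets κ c j).ncard

end ColoredFacets

/-!
Put every color into a random set independently with probability `1 - X` and keep the points whose
color was chosen. A `c`-chromatic colored `j`-facet is a facet of the convex hull of the remaining
points exactly when all `c` colors of its vertices and none of the `j` colors on its positive side
were chosen, which has probability `(1 - X) ^ c * X ^ j`. On the other hand, the hull of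
`k ≥ 2` points in convex and general position has `2 k - 4` facets, so up to terms divisible by
`X ^ (m - 1)`, coming from the samples with at most one color, the expected number of facets is
`2 n (1 - X) - 4`. Dividing by `(1 - X) ^ 3` and comparing coefficients gives the relation.

For the number of facets, fix a linear functional `f` that separates the points. Every facet has one
middle vertex with respect to `f`, so it suffices that every point `v` at which `f` is not extremal
is the middle vertex of exactly two facets. Projecting from `v`, which is an extreme point, turns
the other points into a planar set with points on both sides of a line, and these two facets into
its upper and its lower bridge over that line.
-/

namespace ColoredFacets

open Finset Module Submodule

section Bridge

variable {𝕜 ι : Type*} [Field 𝕜] [LinearOrder 𝕜] [IsStrictOrderedRing 𝕜]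

theorem intercept_nonpos {x₁ x₂ z₁ z₂ m c : 𝕜} (hx₁ : x₁ < 0) (hx₂ : 0 < x₂) (hz₁ : 0 < z₁)
    (hz₂ : 0 < z₂) (h₁ : m * x₁ + c * z₁ ≤ 0) (h₂ : m * x₂ + c * z₂ ≤ 0) : c ≤ 0 := by
  have hcross : c * (x₂ * z₁ - x₁ * z₂) ≤ 0 := by
    linarith [mul_nonpos_of_nonneg_of_nonpos hx₂.le h₁, mul_nonneg_of_nonpos_of_nonpos hx₁.le h₂]
  have hpos : 0 < x₂ * z₁ - x₁ * z₂ := by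
    linarith [mul_pos hx₂ hz₁, mul_neg_of_neg_of_pos hx₁ hz₂]
  exact nonpos_of_mul_nonpos_left hcross hpos

theorem coeffs_eq_zero {x₁ x₂ z₁ z₂ m c : 𝕜} (hx₁ : x₁ < 0) (hx₂ : 0 < x₂) (hz₁ : 0 < z₁)
    (hz₂ : 0 < z₂) (h₁ : m * x₁ + c * z₁ = 0) (h₂ : m * x₂ + c * z₂ = 0) : m = 0 ∧ c = 0 := by
  have hc : c = 0 := by
    refine le_antisymm (intercept_nonpos hx₁ hx₂ hz₁ hz₂ h₁.le h₂.le) ?_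
    refine neg_nonpos.mp (intercept_nonpos (m := -m) hx₁ hx₂ hz₁ hz₂ ?_ ?_) <;> linarith
  refine ⟨?_, hc⟩
  simpa [hc, hx₁.ne] using h₁

/-- The line `y = m x + c` is the bridge over the line `x = 0` of the points
`(f i / g i, h i / g i)`: it lies above all of them and contains one on each side of `x = 0`. The
coordinates are kept homogeneous, with `g` positive in all uses, so that no quotient has to be
formed. -/
def IsUpperBridge (s : Finset ι) (f g h : ι → 𝕜) (m c : 𝕜) : Prop :=
  (∀ i ∈ s, h i ≤ m * f i + c * g i) ∧ (∃ a ∈ s, f a < 0 ∧ h a = m * f a + c * g a) ∧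
    ∃ b ∈ s, 0 < f b ∧ h b = m * f b + c * g b

variable {s : Finset ι} {f g h : ι → 𝕜}

theorem IsUpperBridge.intercept_le {m c m' c' : 𝕜} (hg : ∀ i ∈ s, 0 < g i)
    (hmc : IsUpperBridge s f g h m c) (hmc' : IsUpperBridge s f g h m' c') : c ≤ c' := by
  obtain ⟨-, ⟨a, ha, hfa, hta⟩, b, hb, hfb, htb⟩ := hmc
  rw [← sub_nonpos]
  refine intercept_nonpos (m := m - m') hfa hfb (hg a ha) (hg b hb) ?_ ?_
  · linarith [hmc'.1 a ha]
  · linarith [hmc'.1 b hb]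

theorem IsUpperBridge.unique {m c m' c' : 𝕜} (hg : ∀ i ∈ s, 0 < g i)
    (hmc : IsUpperBridge s f g h m c) (hmc' : IsUpperBridge s f g h m' c') : m = m' ∧ c = c' := by
  obtain rfl : c = c' := le_antisymm (hmc.intercept_le hg hmc') (hmc'.intercept_le hg hmc)
  obtain ⟨-, ⟨a, ha, hfa, hta⟩, b, hb, hfb, htb⟩ := hmc
  have hle : m * f a ≤ m' * f a := by linarith [hmc'.1 a ha]
  have hge : m * f b ≤ m' * f b := by linarith [hmc'.1 b hb]
  exact ⟨le_antisymm (le_of_mul_le_mul_right hge hfb) ((mul_le_mul_right_of_neg hfa).mp hle), rfl⟩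

/-- The bridge joins the pair of points on the two sides of `x = 0` whose connecting line has the
largest intercept. -/
theorem exists_isUpperBridge (hf : ∀ i ∈ s, f i ≠ 0) (hg : ∀ i ∈ s, 0 < g i)
    (hneg : ∃ a ∈ s, f a < 0) (hpos : ∃ b ∈ s, 0 < f b) : ∃ m c, IsUpperBridge s f g h m c := by
  obtain ⟨a₀, ha₀⟩ := hneg
  obtain ⟨b₀, hb₀⟩ := hpos
  obtain ⟨⟨a, b⟩, hab, hmax⟩ := exists_max_image ({i ∈ s | f i < 0} ×ˢ {i ∈ s | 0 < f i})
    (fun p ↦ (f p.2 * h p.1 - f p.1 * h p.2) / (f p.2 * g p.1 - f p.1 * g p.2))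
    ⟨(a₀, b₀), by simp [ha₀, hb₀]⟩
  simp only [mem_product, mem_filter, Prod.forall] at hab hmax
  obtain ⟨⟨ha, hfa⟩, hb, hfb⟩ := hab
  set c := (f b * h a - f a * h b) / (f b * g a - f a * g b) with hc
  have hden {i k} (hi : i ∈ s) (hfi : f i < 0) (hk : k ∈ s) (hfk : 0 < f k) :
      0 < f k * g i - f i * g k := by
    linarith [mul_pos hfk (hg i hi), mul_neg_of_neg_of_pos hfi (hg k hk)]
  have hle {i k} (hi : i ∈ s) (hfi : f i < 0) (hk : k ∈ s) (hfk : 0 < f k) :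
      f k * (h i - c * g i) ≤ f i * (h k - c * g k) := by
    have := (div_le_iff₀ (hden hi hfi hk hfk)).mp (hmax i k ⟨⟨hi, hfi⟩, hk, hfk⟩)
    linarith
  have heq : f b * (h a - c * g a) = f a * (h b - c * g b) := by
    linarith [(eq_div_iff (hden ha hfa hb hfb).ne').mp hc]
  set m := (h a - c * g a) / f a
  have hma : m * f a = h a - c * g a := div_mul_cancel₀ _ hfa.ne
  have hmb : m * f b = h b - c * g b :=
    mul_left_cancel₀ hfa.ne (by linear_combination heq + f b * hma)
  refine ⟨m, c, fun i hi ↦ sub_le_iff_le_add.mp ?_, ⟨a, ha, hfa, by linarith⟩,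
    b, hb, hfb, by linarith⟩
  rcases (hf i hi).lt_or_gt with hfi | hfi
  · refine le_of_mul_le_mul_left ((hle hi hfi hb hfb).trans_eq ?_) hfb
    linear_combination -f i * hmb
  · refine (mul_le_mul_left_of_neg hfa).mp (Eq.trans_le ?_ (hle ha hfa hi hfi))
    linear_combination f i * hma

end Bridge

section SupportingFunctional

theorem exists_ne_zero_forall_dual_apply_eq_zero_iff {K V : Type*} [Field K] [AddCommGroup V]
    [Module K V] {W : Submodule K (Dual K V)} (hW : finrank K W + 1 = finrank K V) :
    ∃ k : V, k ≠ 0 ∧ ∀ F : Dual K V, F k = 0 ↔ F ∈ W := by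
  have : FiniteDimensional K V := finite_of_finrank_pos (by lia)
  have hone : finrank K W.dualCoannihilator = 1 := by
    have := Subspace.finrank_add_finrank_dualCoannihilator_eq W
    lia
  obtain ⟨⟨k, hk⟩, hk0, hspan⟩ := finrank_eq_one_iff'.mp hone
  refine ⟨k, fun h ↦ hk0 (Subtype.ext h), fun F ↦ ⟨fun hF ↦ ?_, fun hF ↦ ?_⟩⟩
  · rw [← Subspace.dualCoannihilator_dualAnnihilator_eq (W := W), mem_dualAnnihilator]
    intro x hx
    obtain ⟨r, hr⟩ := hspan ⟨x, hx⟩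
    have hrx : r • k = x := congrArg Subtype.val hr
    rw [← hrx, map_smul, hF, smul_zero]
  · exact (mem_dualCoannihilator k).mp hk F hF

variable {𝕜 V : Type*} [Field 𝕜] [LinearOrder 𝕜] [IsStrictOrderedRing 𝕜] [AddCommGroup V]
  [Module 𝕜 V] {f g F : Dual 𝕜 V} {a b k v : V} {T : Finset V}

theorem finrank_span_pair_eq_two (hfa : f a < 0) (hfb : 0 < f b) (hga : 0 < g a) (hgb : 0 < g b) :
    finrank 𝕜 (span 𝕜 {f, g}) = 2 := by
  have hli : LinearIndependent 𝕜 ![f, g] := by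
    refine LinearIndependent.pair_iff.mpr fun m c h ↦ coeffs_eq_zero hfa hfb hga hgb ?_ ?_
    · simpa using LinearMap.congr_fun h a
    · simpa using LinearMap.congr_fun h b
  rw [← Matrix.range_cons_cons_empty f g ![], finrank_span_eq_card hli, Fintype.card_fin]

theorem eq_zero_of_mem_span_pair (hfa : f a < 0) (hfb : 0 < f b) (hga : 0 < g a) (hgb : 0 < g b)
    (hF : F ∈ span 𝕜 {f, g}) (hFa : F a = 0) (hFb : F b = 0) : F = 0 := by
  obtain ⟨m, c, rfl⟩ := mem_span_pair.mp hF
  obtain ⟨rfl, rfl⟩ := coeffs_eq_zero (m := m) (c := c) hfa hfb hga hgb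
    (by simpa using hFa) (by simpa using hFb)
  simp

/-- The functional `F` attains its maximum over `T` at `v`, and also at points of `T` on both sides
of the level set of `f` through `v`. -/
def IsBridgeAt (T : Finset V) (v : V) (f F : Dual 𝕜 V) : Prop :=
  (∀ x ∈ T, F x ≤ F v) ∧ (∃ a ∈ T, f a < f v ∧ F a = F v) ∧ ∃ b ∈ T, f v < f b ∧ F b = F v

theorem isBridgeAt_sub_iff_isUpperBridge [DecidableEq V] {h : Dual 𝕜 V} {m c : 𝕜} :
    IsBridgeAt T v f (h - (m • f + c • g)) ↔ IsUpperBridge (T.erase v) (fun x ↦ f (x - v))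
      (fun x ↦ g (x - v)) (fun x ↦ h (x - v)) m c := by
  have hle (x : V) : (h - (m • f + c • g)) x ≤ (h - (m • f + c • g)) v ↔
      h (x - v) ≤ m * f (x - v) + c * g (x - v) := by
    rw [← sub_nonpos, ← map_sub]
    simp only [LinearMap.sub_apply, LinearMap.add_apply, LinearMap.smul_apply, smul_eq_mul,
      sub_nonpos]
  have heq (x : V) : (h - (m • f + c • g)) x = (h - (m • f + c • g)) v ↔
      h (x - v) = m * f (x - v) + c * g (x - v) := by
    rw [← sub_eq_zero, ← map_sub]
    simp only [LinearMap.sub_apply, LinearMap.add_apply, LinearMap.smul_apply, smul_eq_mul,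
      sub_eq_zero]
  simp only [IsBridgeAt, IsUpperBridge, hle, heq, mem_erase, map_sub f, sub_neg, sub_pos]
  refine and_congr ⟨fun H x hx ↦ H x hx.2, fun H x hx ↦ ?_⟩ (and_congr ?_ ?_)
  · rcases eq_or_ne x v with rfl | hxv
    · simp
    · exact H x ⟨hxv, hx⟩
  · exact exists_congr fun x ↦ ⟨fun ⟨hx, hfx, H⟩ ↦ ⟨⟨ne_of_apply_ne f hfx.ne, hx⟩, hfx, H⟩,
      fun ⟨⟨_, hx⟩, H⟩ ↦ ⟨hx, H⟩⟩
  · exact exists_congr fun x ↦ ⟨fun ⟨hx, hfx, H⟩ ↦ ⟨⟨ne_of_apply_ne f hfx.ne', hx⟩, hfx, H⟩,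
      fun ⟨⟨_, hx⟩, H⟩ ↦ ⟨hx, H⟩⟩

/-- Projecting from `v` turns the functionals normalized by `F k = 1` into the lines of a plane, and
the supporting ones with contact points on both sides into bridges. -/
theorem existsUnique_isBridgeAt (hk0 : k ≠ 0) (hk : ∀ F : Dual 𝕜 V, F k = 0 ↔ F ∈ span 𝕜 {f, g})
    (hf : Set.InjOn f T) (hv : v ∈ T) (hg : ∀ x ∈ T, x ≠ v → g v < g x)
    (hlow : ∃ a ∈ T, f a < f v) (hup : ∃ b ∈ T, f v < f b) :
    ∃! F : Dual 𝕜 V, F k = 1 ∧ IsBridgeAt T v f F := by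
  classical
  obtain ⟨h, hhk⟩ : ∃ h : Dual 𝕜 V, h k = 1 := by
    obtain ⟨h, hh⟩ := not_forall.mp (mt (forall_dual_apply_eq_zero_iff 𝕜 k).mp hk0)
    exact ⟨(h k)⁻¹ • h, by simp [hh]⟩
  have hparam (F : Dual 𝕜 V) (hF : F k = 1) : ∃ m c : 𝕜, F = h - (m • f + c • g) := by
    obtain ⟨m, c, hmc⟩ := mem_span_pair.mp ((hk (h - F)).mp (by simp [hF, hhk]))
    exact ⟨m, c, by rw [hmc, sub_sub_cancel]⟩
  have hg' : ∀ x ∈ T.erase v, 0 < g (x - v) := fun x hx ↦ by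
    simpa using hg x (mem_of_mem_erase hx) (ne_of_mem_erase hx)
  obtain ⟨m, c, hmc⟩ := exists_isUpperBridge (h := fun x ↦ h (x - v)) (s := T.erase v)
    (f := fun x ↦ f (x - v)) (g := fun x ↦ g (x - v))
    (fun x hx ↦ by
      simpa [sub_eq_zero] using hf.ne (mem_of_mem_erase hx) hv (ne_of_mem_erase hx))
    hg'
    (hlow.imp fun a ha ↦ ⟨mem_erase.mpr ⟨ne_of_apply_ne f ha.2.ne, ha.1⟩, by simpa using ha.2⟩)
    (hup.imp fun b hb ↦ ⟨mem_erase.mpr ⟨ne_of_apply_ne f hb.2.ne', hb.1⟩, by simpa using hb.2⟩)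
  refine ⟨h - (m • f + c • g), ⟨?_, isBridgeAt_sub_iff_isUpperBridge.mpr hmc⟩, ?_⟩
  · have : (m • f + c • g) k = 0 := (hk _).mpr (mem_span_pair.mpr ⟨m, c, rfl⟩)
    rw [LinearMap.sub_apply, this, hhk, sub_zero]
  · rintro F ⟨hFk, hF⟩
    obtain ⟨m', c', rfl⟩ := hparam F hFk
    obtain ⟨rfl, rfl⟩ := (isBridgeAt_sub_iff_isUpperBridge.mp hF).unique hg' hmc
    rfl

end SupportingFunctional

section Nonextreme

variable {α β : Type*} [LinearOrder β]

open scoped Classical in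
/-- The points of `T` at which `f` attains neither its minimum nor its maximum over `T`. For an
injective `f`, the only such vertex of a triangle is its middle vertex. -/
noncomputable def nonextreme (f : α → β) (T : Finset α) : Finset α :=
  {v ∈ T | (∃ a ∈ T, f a < f v) ∧ ∃ b ∈ T, f v < f b}

theorem mem_nonextreme {f : α → β} {T : Finset α} {v : α} :
    v ∈ nonextreme f T ↔ v ∈ T ∧ (∃ a ∈ T, f a < f v) ∧ ∃ b ∈ T, f v < f b := by
  simp [nonextreme]

theorem nonextreme_mono {f : α → β} {D T : Finset α} (h : D ⊆ T) :
    nonextreme f D ⊆ nonextreme f T := by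
  intro v hv
  obtain ⟨hvD, ⟨a, ha, hav⟩, b, hb, hvb⟩ := mem_nonextreme.mp hv
  exact mem_nonextreme.mpr ⟨h hvD, ⟨a, h ha, hav⟩, b, h hb, hvb⟩

theorem card_nonextreme_add_two {f : α → β} {T : Finset α} (hf : Set.InjOn f T) (hT : 2 ≤ #T) :
    #(nonextreme f T) + 2 = #T := by
  classical
  have hne : T.Nonempty := card_pos.mp (by lia)
  obtain ⟨p, hp, hmin⟩ := T.exists_min_image f hne
  obtain ⟨q, hq, hmax⟩ := T.exists_max_image f hne
  have hlt {x} (hx : x ∈ T) (hxp : x ≠ p) : f p < f x := (hmin x hx).lt_of_ne (hf.ne hp hx hxp.symm)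
  have hgt {x} (hx : x ∈ T) (hxq : x ≠ q) : f x < f q := (hmax x hx).lt_of_ne (hf.ne hx hq hxq)
  have hqp : q ≠ p := by
    obtain ⟨x, hx, hxp⟩ := exists_mem_ne hT p
    rintro rfl
    exact (hlt hx hxp).not_ge (hmax x hx)
  have herase : nonextreme f T = (T.erase p).erase q := by
    ext v
    rw [mem_nonextreme, mem_erase, mem_erase]
    constructor
    · rintro ⟨hv, ⟨a, ha, hav⟩, b, hb, hvb⟩
      exact ⟨fun h ↦ (h ▸ hvb).not_ge (hmax b hb), fun h ↦ (h ▸ hav).not_ge (hmin a ha), hv⟩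
    · rintro ⟨hvq, hvp, hv⟩
      exact ⟨hv, ⟨p, hp, hlt hv hvp⟩, q, hq, hgt hv hvq⟩
  rw [herase, ← card_erase_add_one hp, ← card_erase_add_one (mem_erase.mpr ⟨hqp, hq⟩)]

end Nonextreme

section OrientedSimplex

variable {d : ℕ} {S T : Finset (EuclideanSpace ℝ (Fin d))} {σ τ : OrientedSimplex d}
  {v k : EuclideanSpace ℝ (Fin d)} {f F : Dual ℝ (EuclideanSpace ℝ (Fin d))} {α : ℝ}

theorem vectorSpan_le_ker {R V : Type*} [Ring R] [AddCommGroup V] [Module R V] {F : Dual R V}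
    {s : Set V} {α : R} (h : ∀ p ∈ s, F p = α) : vectorSpan R s ≤ LinearMap.ker F := by
  refine span_le.mpr ?_
  rintro _ ⟨p, hp, q, hq, rfl⟩
  simp [h p hp, h q hq]

theorem exists_dual_injOn {K V : Type*} [Field K] [Infinite K] [AddCommGroup V] [Module K V]
    (T : Finset V) : ∃ f : Dual K V, Set.InjOn f T := by
  obtain ⟨f, hf⟩ := exists_dual_forall_apply_ne_zero (K := K)
    (fun p : {p : T × T // p.1 ≠ p.2} ↦ (p.1.1 : V) - p.1.2)
    (fun p hp ↦ p.2 (Subtype.ext (sub_eq_zero.mp hp)))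
  refine ⟨f, fun x hx y hy hxy ↦ ?_⟩
  by_contra hne
  refine hf ⟨(⟨x, hx⟩, ⟨y, hy⟩), fun h ↦ hne (congrArg Subtype.val h)⟩ ?_
  rw [map_sub, hxy, sub_self]

theorem InGeneralPosition.mono (hS : InGeneralPosition S) (h : T ⊆ S) : InGeneralPosition T :=
  fun D hD ↦ hS D (hD.trans h)

theorem InConvexPosition.mono (hS : InConvexPosition S) (h : T ⊆ S) : InConvexPosition T :=
  ConvexIndependent.mono (t := (S : Set (EuclideanSpace ℝ (Fin d)))) hS (coe_subset.mpr h)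

theorem InConvexPosition.exists_dual_forall_lt (hT : InConvexPosition T) (hv : v ∈ T) :
    ∃ g : Dual ℝ (EuclideanSpace ℝ (Fin d)), ∀ x ∈ T, x ≠ v → g v < g x := by
  have hnot := (convexIndependent_set_iff_notMem_convexHull_sdiff
    (s := (T : Set (EuclideanSpace ℝ (Fin d))))).mp hT v hv
  have hclosed : IsClosed (convexHull ℝ ((T : Set (EuclideanSpace ℝ (Fin d))) \ {v})) :=
    T.finite_toSet.sdiff.isClosed_convexHull ℝ
  obtain ⟨g, u, hgv, hgu⟩ :=
    geometric_hahn_banach_point_closed (convex_convexHull ℝ _) hclosed hnot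
  exact ⟨g.toLinearMap, fun x hx hxv ↦ hgv.trans (hgu x (subset_convexHull ℝ _ ⟨hx, hxv⟩))⟩

theorem InGeneralPosition.card_filter_eq_le (hS : InGeneralPosition S) (hF : F ≠ 0) (α : ℝ) :
    #{x ∈ S | F x = α} ≤ d := by
  by_contra! hlt
  obtain ⟨D, hD, hcard⟩ := exists_subset_card_eq (Nat.succ_le_of_lt hlt)
  have hind := hS D (hD.trans (filter_subset _ _)) hcard.le
  have htop := hind.vectorSpan_eq_top_of_card_eq_finrank_add_one (by simp [hcard])
  have hker : vectorSpan ℝ (Set.range ((↑) : D → EuclideanSpace ℝ (Fin d))) ≤ LinearMap.ker F :=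
    vectorSpan_le_ker (α := α) (by
      rintro _ ⟨⟨p, hp⟩, rfl⟩
      exact (mem_filter.mp (hD hp)).2)
  exact hF (LinearMap.ker_eq_top.mp (top_unique (htop ▸ hker)))

theorem verts_eq_filter (hS : InGeneralPosition S) (hσ : σ.verts ⊆ S) (hF : F ≠ 0)
    (h : ∀ p ∈ σ.verts, F p = α) : σ.verts = {x ∈ S | F x = α} := by
  refine eq_of_subset_of_card_le (fun p hp ↦ mem_filter.mpr ⟨hσ hp, h p hp⟩) ?_
  rw [σ.card_verts]
  exact hS.card_filter_eq_le hF α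

theorem exists_verts_eq_filter (hS : InGeneralPosition S) (hF : F ≠ 0)
    (hcard : d ≤ #{x ∈ S | F x = α}) :
    ∃ σ : OrientedSimplex d, σ.verts = {x ∈ S | F x = α} ∧ σ.posSide = {x | α < F x} := by
  have hle := hS.card_filter_eq_le hF α
  exact ⟨⟨_, hle.antisymm hcard, hS _ (filter_subset _ _) (hle.trans d.le_succ), _, F, α, hF,
    fun p hp ↦ (mem_filter.mp hp).2, rfl⟩, rfl, rfl⟩

theorem OrientedSimplex.exists_dual (hv : v ∈ σ.verts) :
    ∃ F : Dual ℝ (EuclideanSpace ℝ (Fin d)),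
      F ≠ 0 ∧ (∀ p ∈ σ.verts, F p = F v) ∧ σ.posSide = {x | F v < F x} := by
  obtain ⟨F, α, hF, hverts, hside⟩ := σ.isHalfSpace
  obtain rfl := hverts v hv
  exact ⟨F, hF, hverts, hside⟩

theorem OrientedSimplex.exists_dual_apply_eq_one (hv : v ∈ σ.verts) (hk : v + k ∈ σ.posSide) :
    ∃ F : Dual ℝ (EuclideanSpace ℝ (Fin d)),
      F k = 1 ∧ (∀ p ∈ σ.verts, F p = F v) ∧ σ.posSide = {x | F v < F x} := by
  obtain ⟨F, -, hverts, hside⟩ := OrientedSimplex.exists_dual hv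
  have hFk : 0 < F k := by simpa [hside] using hk
  refine ⟨(F k)⁻¹ • F, inv_mul_cancel₀ hFk.ne', fun p hp ↦ ?_, ?_⟩
  · rw [LinearMap.smul_apply, LinearMap.smul_apply, hverts p hp]
  · simp [hside, hFk]

theorem OrientedSimplex.notMem_posSide (hv : v ∈ σ.verts) : v ∉ σ.posSide := by
  obtain ⟨F, -, -, hside⟩ := OrientedSimplex.exists_dual hv
  simp [hside]

theorem OrientedSimplex.sub_notMem_posSide (hv : v ∈ σ.verts) (hk : v + k ∈ σ.posSide) :
    v - k ∉ σ.posSide := by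
  obtain ⟨F, hFk, -, hside⟩ := OrientedSimplex.exists_dual_apply_eq_one hv hk
  simp [hside, hFk]

theorem mem_facets_zero : σ ∈ facets T 0 ↔ σ.verts ⊆ T ∧ ∀ x ∈ T, x ∉ σ.posSide := by
  have hfin : {s | s ∈ T ∧ s ∈ σ.posSide}.Finite := T.finite_toSet.subset fun s hs ↦ hs.1
  rw [facets, Set.mem_ofPred_eq, Set.ncard_eq_zero hfin, Set.eq_empty_iff_forall_notMem]
  simp

theorem isBridgeAt_of_mem_facets_zero (hσ : σ ∈ facets T 0) (hv : v ∈ nonextreme f σ.verts)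
    (hverts : ∀ p ∈ σ.verts, F p = F v) (hside : σ.posSide = {x | F v < F x}) :
    IsBridgeAt T v f F := by
  obtain ⟨hσT, hempty⟩ := mem_facets_zero.mp hσ
  obtain ⟨-, ⟨a, ha, hav⟩, b, hb, hvb⟩ := mem_nonextreme.mp hv
  refine ⟨fun x hx ↦ ?_, ⟨a, hσT ha, hav, hverts a ha⟩, b, hσT hb, hvb, hverts b hb⟩
  simpa [hside] using hempty x hx

theorem OrientedSimplex.verts_nonempty (σ : OrientedSimplex d) : σ.verts.Nonempty := by
  rw [nonempty_iff_ne_empty]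
  intro h
  obtain rfl : 0 = d := by simpa [h] using σ.card_verts
  obtain ⟨F, -, hF, -⟩ := σ.isHalfSpace
  exact hF (Subsingleton.elim F 0)

theorem OrientedSimplex.posSide_eq_or_eq (hverts : τ.verts = σ.verts) (hv : v ∈ σ.verts)
    (hF : F ≠ 0) (h : ∀ p ∈ σ.verts, F p = F v) :
    τ.posSide = {x | F v < F x} ∨ τ.posSide = {x | F x < F v} := by
  set W := vectorSpan ℝ (Set.range ((↑) : σ.verts → EuclideanSpace ℝ (Fin d)))
  have : Nonempty σ.verts := ⟨v, hv⟩
  have hone : finrank ℝ W.dualAnnihilator = 1 := by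
    have hW := σ.affineIndependent.finrank_vectorSpan_add_one
    have hann := Subspace.finrank_add_finrank_dualAnnihilator_eq W
    rw [Fintype.card_coe, σ.card_verts] at hW
    rw [finrank_euclideanSpace_fin] at hann
    exact Nat.add_left_cancel (hann.trans hW.symm)
  have hmem {G : Dual ℝ (EuclideanSpace ℝ (Fin d))} (hG : ∀ p ∈ σ.verts, G p = G v) :
      G ∈ W.dualAnnihilator :=
    (mem_dualAnnihilator G).mpr fun w hw ↦ vectorSpan_le_ker (by simpa using hG) hw
  obtain ⟨G, hG, hGverts, hside⟩ := OrientedSimplex.exists_dual (hverts ▸ hv)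
  obtain ⟨r, hr⟩ := (finrank_eq_one_iff_of_nonzero' (⟨F, hmem h⟩ : W.dualAnnihilator)
    (by simpa using hF)).mp hone ⟨G, hmem (hverts ▸ hGverts)⟩
  obtain rfl : r • F = G := congrArg Subtype.val hr
  rcases lt_trichotomy r 0 with hneg | rfl | hpos
  · right
    simpa [hneg] using hside
  · exact (hG (zero_smul ℝ F)).elim
  · left
    simpa [hpos] using hside

end OrientedSimplex

section FacetCount

variable {T : Finset (EuclideanSpace ℝ (Fin 3))} {f g : Dual ℝ (EuclideanSpace ℝ (Fin 3))}
  {k v : EuclideanSpace ℝ (Fin 3)} {σ : OrientedSimplex 3}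

theorem existsUnique_facet (hT : InGeneralPosition T) (hk0 : k ≠ 0)
    (hk : ∀ F : Dual ℝ (EuclideanSpace ℝ (Fin 3)), F k = 0 ↔ F ∈ span ℝ {f, g})
    (hf : Set.InjOn f T) (hv : v ∈ nonextreme f T) (hg : ∀ x ∈ T, x ≠ v → g v < g x) :
    ∃! σ : OrientedSimplex 3,
      (σ ∈ facets T 0 ∧ v ∈ nonextreme f σ.verts) ∧ v + k ∈ σ.posSide := by
  obtain ⟨hvT, hlow, hup⟩ := mem_nonextreme.mp hv
  obtain ⟨F, ⟨hFk, hF⟩, huniq⟩ := existsUnique_isBridgeAt hk0 hk hf hvT hg hlow hup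
  have hF0 : F ≠ 0 := by
    rintro rfl
    simp at hFk
  obtain ⟨hle, ⟨a, ha, hav, hFa⟩, b, hb, hvb, hFb⟩ := hF
  have hcard : 3 ≤ #{x ∈ T | F x = F v} := two_lt_card.mpr
    ⟨a, by simp [ha, hFa], v, by simp [hvT], b, by simp [hb, hFb],
      ne_of_apply_ne f hav.ne, ne_of_apply_ne f (hav.trans hvb).ne, ne_of_apply_ne f hvb.ne⟩
  obtain ⟨σ, hverts, hside⟩ := exists_verts_eq_filter hT hF0 hcard
  refine ⟨σ, ⟨⟨mem_facets_zero.mpr ⟨hverts ▸ filter_subset _ _, fun x hx ↦ ?_⟩, ?_⟩, ?_⟩, ?_⟩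
  · simpa [hside] using hle x hx
  · rw [hverts, mem_nonextreme]
    exact ⟨by simp [hvT], ⟨a, by simp [ha, hFa], hav⟩, b, by simp [hb, hFb], hvb⟩
  · simp [hside, hFk]
  · rintro τ ⟨⟨hτ, hvτ⟩, hkτ⟩
    obtain ⟨G, hGk, hGverts, hGside⟩ :=
      OrientedSimplex.exists_dual_apply_eq_one (mem_nonextreme.mp hvτ).1 hkτ
    obtain rfl := huniq G ⟨hGk, isBridgeAt_of_mem_facets_zero hτ hvτ hGverts hGside⟩
    have hτverts := verts_eq_filter hT (mem_facets_zero.mp hτ).1 hF0 hGverts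
    exact OrientedSimplex.ext (hτverts.trans hverts.symm) (hGside.trans hside.symm)

theorem add_mem_posSide_or_sub_mem_posSide
    (hk : ∀ F : Dual ℝ (EuclideanSpace ℝ (Fin 3)), F k = 0 ↔ F ∈ span ℝ {f, g})
    (hv : v ∈ nonextreme f σ.verts) (hg : ∀ x ∈ σ.verts, x ≠ v → g v < g x) :
    v + k ∈ σ.posSide ∨ v - k ∈ σ.posSide := by
  obtain ⟨hvσ, ⟨a, ha, hav⟩, b, hb, hvb⟩ := mem_nonextreme.mp hv
  obtain ⟨F, hF, hverts, hside⟩ := OrientedSimplex.exists_dual hvσ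
  have hFk : F k ≠ 0 := fun h ↦ hF <| eq_zero_of_mem_span_pair (a := a - v) (b := b - v)
    (by simpa using hav) (by simpa using hvb)
    (by simpa using hg a ha (ne_of_apply_ne f hav.ne))
    (by simpa using hg b hb (ne_of_apply_ne f hvb.ne')) ((hk F).mp h)
    (by simp [hverts a ha]) (by simp [hverts b hb])
  rw [hside]
  simpa only [Set.mem_ofPred_eq, map_add, map_sub, lt_add_iff_pos_right, lt_sub_comm, sub_self]
    using hFk.lt_or_gt.symm

theorem ncard_facets_nonextreme (hconv : InConvexPosition T) (hT : InGeneralPosition T)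
    (hf : Set.InjOn f T) (hv : v ∈ nonextreme f T) :
    {σ | σ ∈ facets T 0 ∧ v ∈ nonextreme f σ.verts}.ncard = 2 := by
  obtain ⟨hvT, ⟨a, ha, hav⟩, b, hb, hvb⟩ := mem_nonextreme.mp hv
  obtain ⟨g, hg⟩ := hconv.exists_dual_forall_lt hvT
  have hrank : finrank ℝ (span ℝ {f, g}) = 2 :=
    finrank_span_pair_eq_two (a := a - v) (b := b - v) (by simpa using hav) (by simpa using hvb)
      (by simpa using hg a ha (ne_of_apply_ne f hav.ne))
      (by simpa using hg b hb (ne_of_apply_ne f hvb.ne'))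
  obtain ⟨k, hk0, hk⟩ := exists_ne_zero_forall_dual_apply_eq_zero_iff
    (W := span ℝ {f, g}) (by rw [hrank, finrank_euclideanSpace_fin])
  obtain ⟨σ, ⟨hσ, hσk⟩, hσuniq⟩ := existsUnique_facet hT hk0 hk hf hv hg
  obtain ⟨τ, ⟨hτ, hτk⟩, hτuniq⟩ := existsUnique_facet (k := -k) hT (neg_ne_zero.mpr hk0)
    (fun F ↦ by rw [map_neg, neg_eq_zero, hk]) hf hv hg
  simp only [← sub_eq_add_neg] at hτk hτuniq
  refine Set.ncard_eq_two.mpr ⟨σ, τ, ?_, Set.ext fun ρ ↦ ⟨fun hρ ↦ ?_, ?_⟩⟩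
  · rintro rfl
    exact OrientedSimplex.sub_notMem_posSide (mem_nonextreme.mp hσ.2).1 hσk hτk
  · have hρT := (mem_facets_zero.mp hρ.1).1
    exact (add_mem_posSide_or_sub_mem_posSide hk hρ.2 fun x hx ↦ hg x (hρT hx)).imp
      (fun h ↦ hσuniq ρ ⟨hρ, h⟩) (fun h ↦ hτuniq ρ ⟨hρ, h⟩)
  · rintro (rfl | rfl)
    exacts [hσ, hτ]

theorem finite_setOf_verts_subset {d : ℕ} (S : Finset (EuclideanSpace ℝ (Fin d))) :
    {σ : OrientedSimplex d | σ.verts ⊆ S}.Finite := by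
  have hfiber (D : Finset (EuclideanSpace ℝ (Fin d))) :
      {σ : OrientedSimplex d | σ.verts = D}.Finite := by
    rcases Set.eq_empty_or_nonempty {σ : OrientedSimplex d | σ.verts = D} with h | ⟨σ, rfl⟩
    · exact h ▸ Set.finite_empty
    obtain ⟨v, hv⟩ := σ.verts_nonempty
    obtain ⟨F, hF, hverts, -⟩ := OrientedSimplex.exists_dual hv
    refine Set.Finite.of_finite_image (f := OrientedSimplex.posSide) ?_ fun τ hτ ρ hρ h ↦
      OrientedSimplex.ext (hτ.trans hρ.symm) h
    refine (Set.toFinite {{x | F v < F x}, {x | F x < F v}}).subset ?_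
    rintro _ ⟨τ, hτ, rfl⟩
    exact OrientedSimplex.posSide_eq_or_eq hτ hv hF hverts
  refine (S.powerset.finite_toSet.biUnion fun D _ ↦ hfiber D).subset fun σ hσ ↦ ?_
  exact Set.mem_biUnion (mem_coe.mpr (mem_powerset.mpr hσ)) rfl

theorem ncard_facets_zero_add_four (hconv : InConvexPosition T) (hT : InGeneralPosition T)
    (hcard : 2 ≤ #T) : (facets T 0).ncard + 4 = 2 * #T := by
  classical
  obtain ⟨f, hf⟩ := exists_dual_injOn (K := ℝ) T
  have hfin : (facets T 0).Finite := (finite_setOf_verts_subset T).subset fun σ hσ ↦ hσ.1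
  let r (σ : OrientedSimplex 3) (v : EuclideanSpace ℝ (Fin 3)) : Prop := v ∈ nonextreme f σ.verts
  have hone : ∀ σ ∈ hfin.toFinset, #((nonextreme f T).bipartiteAbove r σ) = 1 := by
    intro σ hσ
    have hσT : σ.verts ⊆ T := ((Set.Finite.mem_toFinset hfin).mp hσ).1
    have hmiddle := card_nonextreme_add_two (hf.mono (coe_subset.mpr hσT)) (by simp [σ.card_verts])
    rw [σ.card_verts] at hmiddle
    rw [bipartiteAbove, filter_mem_eq_inter, inter_eq_right.mpr (nonextreme_mono hσT)]
    exact Nat.add_right_cancel hmiddle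
  have htwo : ∀ v ∈ nonextreme f T, #(hfin.toFinset.bipartiteBelow r v) = 2 := by
    intro v hv
    rw [← ncard_facets_nonextreme hconv hT hf hv, ← Set.ncard_coe_finset, coe_bipartiteBelow]
    simp [r]
  have hdouble := card_mul_eq_card_mul r hone htwo
  have hnonextreme := card_nonextreme_add_two hf hcard
  rw [Set.ncard_eq_toFinset_card _ hfin]
  lia

end FacetCount

section Sampling

variable {ι Λ K : Type*} [CommRing Λ] {p q : Λ}

theorem sum_Icc_pow_mul_pow [DecidableEq K] (hpq : p + q = 1) {B C U : Finset K} (hBC : B ⊆ C)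
    (hCU : C ⊆ U) : ∑ R ∈ Icc B C, p ^ #R * q ^ (#U - #R) = p ^ #B * q ^ (#U - #C) := by
  have hdisj {D : Finset K} (hD : D ∈ (C \ B).powerset) : Disjoint B D :=
    disjoint_sdiff.mono_right (mem_powerset.mp hD)
  have hinj : Set.InjOn (B ∪ ·) (C \ B).powerset := fun D hD D' hD' (h : B ∪ D = B ∪ D') ↦ by
    rw [← union_sdiff_cancel_left (hdisj hD), h, union_sdiff_cancel_left (hdisj hD')]
  rw [Icc_eq_image_powerset hBC, sum_image hinj]
  calc ∑ D ∈ (C \ B).powerset, p ^ #(B ∪ D) * q ^ (#U - #(B ∪ D))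
      = ∑ D ∈ (C \ B).powerset,
          p ^ #B * q ^ (#U - #C) * (p ^ #D * q ^ (#(C \ B) - #D)) := by
        refine sum_congr rfl fun D hD ↦ ?_
        have hDC := card_le_card (mem_powerset.mp hD)
        have hcard := card_sdiff_add_card_eq_card hBC
        have hle := card_le_card hCU
        have hexp : #U - (#B + #D) = #U - #C + (#(C \ B) - #D) := by lia
        rw [card_union_of_disjoint (hdisj hD), hexp, pow_add, pow_add]
        ring
    _ = p ^ #B * q ^ (#U - #C) := by
        rw [← mul_sum, sum_pow_mul_eq_add_pow, hpq, one_pow, mul_one]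

/-- Both sides are the expected number of `i ∈ s` with `B i ⊆ R ⊆ C i` when the elements of `U` are
put into `R` independently with probability `p`. -/
theorem sum_powerset_pow_mul_pow_mul_card [DecidableEq K] (hpq : p + q = 1) {U : Finset K}
    (s : Finset ι) {B C : ι → Finset K} (hBC : ∀ i ∈ s, B i ⊆ C i) (hCU : ∀ i ∈ s, C i ⊆ U) :
    ∑ R ∈ U.powerset, p ^ #R * q ^ (#U - #R) * (#{i ∈ s | B i ⊆ R ∧ R ⊆ C i} : Λ) =
      ∑ i ∈ s, p ^ #(B i) * q ^ (#U - #(C i)) := by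
  calc ∑ R ∈ U.powerset, p ^ #R * q ^ (#U - #R) * (#{i ∈ s | B i ⊆ R ∧ R ⊆ C i} : Λ)
      = ∑ R ∈ U.powerset, ∑ i ∈ s with B i ⊆ R ∧ R ⊆ C i, p ^ #R * q ^ (#U - #R) := by
        simp only [sum_const, nsmul_eq_mul, mul_comm]
    _ = ∑ i ∈ s, ∑ R ∈ Icc (B i) (C i), p ^ #R * q ^ (#U - #R) := by
        refine sum_comm' fun R i ↦ ?_
        simp only [mem_powerset, mem_filter, mem_Icc]
        exact ⟨fun h ↦ ⟨h.2.2, h.2.1⟩, fun h ↦ ⟨h.1.2.trans (hCU i h.2), h.2, h.1⟩⟩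
    _ = ∑ i ∈ s, p ^ #(B i) * q ^ (#U - #(C i)) :=
        sum_congr rfl fun i hi ↦ sum_Icc_pow_mul_pow hpq (hBC i hi) (hCU i hi)

variable {d : ℕ} {S : Finset (EuclideanSpace ℝ (Fin d))} {κ : S → K} {R : Finset K}
  {σ : OrientedSimplex d}

/-- `colorsOf` as a `Finset`. -/
noncomputable def colorFinset (κ : S → K) (A : Set (EuclideanSpace ℝ (Fin d))) : Finset K :=
  (Set.toFinite (κ '' (Subtype.val ⁻¹' A))).toFinset

theorem coe_colorFinset (κ : S → K) (A : Set (EuclideanSpace ℝ (Fin d))) :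
    (colorFinset κ A : Set K) = colorsOf κ A :=
  Set.Finite.coe_toFinset _

theorem card_colorFinset (κ : S → K) (A : Set (EuclideanSpace ℝ (Fin d))) :
    #(colorFinset κ A) = (colorsOf κ A).ncard := by
  rw [← coe_colorFinset, Set.ncard_coe_finset]

theorem mem_colorFinset {A : Set (EuclideanSpace ℝ (Fin d))} {i : K} :
    i ∈ colorFinset κ A ↔ ∃ s : S, (s : EuclideanSpace ℝ (Fin d)) ∈ A ∧ κ s = i := by
  rw [← mem_coe, coe_colorFinset]
  rfl

theorem colorFinset_mono {A B : Set (EuclideanSpace ℝ (Fin d))} (h : A ⊆ B) :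
    colorFinset κ A ⊆ colorFinset κ B := fun i hi ↦ by
  obtain ⟨s, hs, hsi⟩ := mem_colorFinset.mp hi
  exact mem_colorFinset.mpr ⟨s, h hs, hsi⟩

theorem card_colorFinset_verts_le (κ : S → K) (σ : OrientedSimplex d) :
    #(colorFinset κ σ.verts) ≤ d := by
  have hsub : Subtype.val '' (Subtype.val ⁻¹' σ.verts : Set S) ⊆ (σ.verts : Set _) :=
    Set.image_preimage_subset _ _
  calc #(colorFinset κ σ.verts) = (κ '' (Subtype.val ⁻¹' σ.verts)).ncard := card_colorFinset _ _
    _ ≤ (Subtype.val ⁻¹' σ.verts : Set S).ncard := Set.ncard_image_le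
    _ = (Subtype.val '' (Subtype.val ⁻¹' σ.verts : Set S)).ncard :=
        (Set.ncard_image_of_injective _ Subtype.val_injective).symm
    _ ≤ (σ.verts : Set _).ncard := Set.ncard_le_ncard hsub σ.verts.finite_toSet
    _ = d := by rw [Set.ncard_coe_finset, σ.card_verts]

theorem card_colorFinset_verts_pos (hσ : σ.verts ⊆ S) : 0 < #(colorFinset κ σ.verts) := by
  obtain ⟨v, hv⟩ := σ.verts_nonempty
  exact card_pos.mpr ⟨_, mem_colorFinset.mpr ⟨⟨v, hσ hv⟩, hv, rfl⟩⟩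

open scoped Classical in
/-- The points of `S` whose color belongs to `R`. -/
noncomputable def pointsWithColor (κ : S → K) (R : Finset K) :
    Finset (EuclideanSpace ℝ (Fin d)) :=
  {s ∈ S.attach | κ s ∈ R}.map (Function.Embedding.subtype _)

theorem mem_pointsWithColor {x : EuclideanSpace ℝ (Fin d)} :
    x ∈ pointsWithColor κ R ↔ ∃ h : x ∈ S, κ ⟨x, h⟩ ∈ R := by
  simp [pointsWithColor]

theorem pointsWithColor_subset (κ : S → K) (R : Finset K) : pointsWithColor κ R ⊆ S :=
  fun _ hx ↦ (mem_pointsWithColor.mp hx).1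

theorem card_le_card_pointsWithColor (hR : R ⊆ colorFinset κ Set.univ) :
    #R ≤ #(pointsWithColor κ R) := by
  classical
  rw [pointsWithColor, card_map]
  refine (card_le_card fun i hi ↦ ?_).trans (card_image_le (f := κ))
  obtain ⟨s, -, rfl⟩ := mem_colorFinset.mp (hR hi)
  exact mem_image_of_mem κ (by simpa using hi)

/-- The simplices that belong to `chromaticFacets κ c j` for some `c` and `j`. -/
noncomputable def coloredFacets (κ : S → K) : Finset (OrientedSimplex d) :=
  Set.Finite.toFinset (s := {σ | σ.verts ⊆ S ∧
    Disjoint (colorFinset κ σ.posSide) (colorFinset κ σ.verts)})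
    ((finite_setOf_verts_subset S).subset fun _ hσ ↦ hσ.1)

theorem mem_coloredFacets : σ ∈ coloredFacets κ ↔
    σ.verts ⊆ S ∧ Disjoint (colorFinset κ σ.posSide) (colorFinset κ σ.verts) :=
  Set.Finite.mem_toFinset _

theorem mem_chromaticFacets {c j : ℕ} : σ ∈ chromaticFacets κ c j ↔ σ ∈ coloredFacets κ ∧
    #(colorFinset κ σ.posSide) = j ∧ #(colorFinset κ σ.verts) = c := by
  rw [mem_coloredFacets, ← disjoint_coe, coe_colorFinset, coe_colorFinset, card_colorFinset,
    card_colorFinset, and_assoc]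
  rfl

theorem mem_facets_pointsWithColor : σ ∈ facets (pointsWithColor κ R) 0 ↔
    σ.verts ⊆ S ∧ colorFinset κ σ.verts ⊆ R ∧ Disjoint (colorFinset κ σ.posSide) R := by
  rw [mem_facets_zero, ← and_assoc, disjoint_left]
  refine and_congr ⟨fun h ↦ ⟨h.trans (pointsWithColor_subset κ R), fun i hi ↦ ?_⟩, ?_⟩ ⟨?_, ?_⟩
  · obtain ⟨s, hs, rfl⟩ := mem_colorFinset.mp hi
    exact (mem_pointsWithColor.mp (h hs)).2
  · rintro ⟨hσ, h⟩ x hx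
    exact mem_pointsWithColor.mpr ⟨hσ hx, h (mem_colorFinset.mpr ⟨⟨x, hσ hx⟩, hx, rfl⟩)⟩
  · rintro h i hi hiR
    obtain ⟨s, hs, rfl⟩ := mem_colorFinset.mp hi
    exact h s (mem_pointsWithColor.mpr ⟨s.2, hiR⟩) hs
  · intro h x hx hxσ
    obtain ⟨hxS, hxR⟩ := mem_pointsWithColor.mp hx
    exact h (mem_colorFinset.mpr ⟨⟨x, hxS⟩, hxσ, rfl⟩) hxR

theorem ncard_facets_pointsWithColor [DecidableEq K] (hR : R ⊆ colorFinset κ Set.univ) :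
    (facets (pointsWithColor κ R) 0).ncard = #{σ ∈ coloredFacets κ |
      colorFinset κ σ.verts ⊆ R ∧ R ⊆ colorFinset κ Set.univ \ colorFinset κ σ.posSide} := by
  rw [← Set.ncard_coe_finset]
  congr 1
  ext σ
  simp only [coe_filter, Set.mem_ofPred_eq, mem_facets_pointsWithColor, mem_coloredFacets,
    subset_sdiff, hR, true_and]
  exact ⟨fun h ↦ ⟨⟨h.1, h.2.2.mono_right h.2.1⟩, h.2.1, h.2.2.symm⟩,
    fun h ↦ ⟨h.1.1, h.2.1, h.2.2.symm⟩⟩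

theorem sum_mul_ncard_facets_pointsWithColor (hpq : p + q = 1) (κ : S → K) :
    ∑ R ∈ (colorFinset κ Set.univ).powerset, p ^ #R * q ^ (#(colorFinset κ Set.univ) - #R) *
        ((facets (pointsWithColor κ R) 0).ncard : Λ) =
      ∑ σ ∈ coloredFacets κ, p ^ #(colorFinset κ σ.verts) * q ^ #(colorFinset κ σ.posSide) := by
  classical
  set U := colorFinset κ Set.univ
  have hU (A : Set (EuclideanSpace ℝ (Fin d))) : colorFinset κ A ⊆ U :=
    colorFinset_mono (Set.subset_univ A)
  calc _ = ∑ R ∈ U.powerset, p ^ #R * q ^ (#U - #R) * (#{σ ∈ coloredFacets κ |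
          colorFinset κ σ.verts ⊆ R ∧ R ⊆ U \ colorFinset κ σ.posSide} : Λ) :=
        sum_congr rfl fun R hR ↦ by rw [ncard_facets_pointsWithColor (mem_powerset.mp hR)]
    _ = ∑ σ ∈ coloredFacets κ,
          p ^ #(colorFinset κ σ.verts) * q ^ (#U - #(U \ colorFinset κ σ.posSide)) :=
        sum_powerset_pow_mul_pow_mul_card hpq _
          (fun σ hσ ↦ subset_sdiff.mpr ⟨hU _, (mem_coloredFacets.mp hσ).2.symm⟩)
          fun σ _ ↦ sdiff_subset
    _ = _ := sum_congr rfl fun σ _ ↦ by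
        rw [← card_sdiff_of_subset sdiff_subset, Finset.sdiff_sdiff_eq_self (hU _)]

theorem sum_mul_card_pointsWithColor (hpq : p + q = 1) (κ : S → K) :
    ∑ R ∈ (colorFinset κ Set.univ).powerset, p ^ #R * q ^ (#(colorFinset κ Set.univ) - #R) *
      (#(pointsWithColor κ R) : Λ) = #S * p := by
  classical
  set U := colorFinset κ Set.univ
  calc _ = ∑ R ∈ U.powerset,
          p ^ #R * q ^ (#U - #R) * (#{s ∈ S.attach | {κ s} ⊆ R ∧ R ⊆ U} : Λ) :=
        sum_congr rfl fun R hR ↦ by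
          simp only [pointsWithColor, card_map, singleton_subset_iff, mem_powerset.mp hR, and_true]
    _ = ∑ s ∈ S.attach, p ^ #{κ s} * q ^ (#U - #U) :=
        sum_powerset_pow_mul_pow_mul_card hpq _
          (fun s _ ↦ singleton_subset_iff.mpr (mem_colorFinset.mpr ⟨s, trivial, rfl⟩))
          fun _ _ ↦ subset_rfl
    _ = #S * p := by simp

end Sampling

section FacetSeries

open PowerSeries

variable {d : ℕ} {K : Type*} {S : Finset (EuclideanSpace ℝ (Fin d))}

/-- The generating function of the numbers of `c`-chromatic colored `j`-facets, with `j` varying. -/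
noncomputable def facetSeries (κ : S → K) (c : ℕ) : ℤ⟦X⟧ :=
  PowerSeries.mk fun j ↦ (e κ c j : ℤ)

theorem facetSeries_eq_sum (κ : S → K) (c : ℕ) : facetSeries κ c =
    ∑ σ ∈ coloredFacets κ with #(colorFinset κ σ.verts) = c, X ^ #(colorFinset κ σ.posSide) := by
  ext j
  have he : e κ c j = #{σ ∈ coloredFacets κ |
      #(colorFinset κ σ.verts) = c ∧ #(colorFinset κ σ.posSide) = j} := by
    rw [e, ← Set.ncard_coe_finset]
    congr 1
    ext σ
    rw [mem_chromaticFacets, mem_coe, mem_filter, and_comm (a := #_ = j)]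
  rw [facetSeries, coeff_mk, he, map_sum, ← filter_filter]
  simp only [coeff_X_pow, sum_boole, eq_comm (a := j)]

theorem sum_one_sub_X_pow_mul_facetSeries (κ : S → K) :
    ∑ c ∈ Icc 1 d, (1 - X) ^ c * facetSeries κ c =
      ∑ σ ∈ coloredFacets κ,
        (1 - X) ^ #(colorFinset κ σ.verts) * X ^ #(colorFinset κ σ.posSide) := by
  have hmem : ∀ σ ∈ coloredFacets κ, #(colorFinset κ σ.verts) ∈ Icc 1 d := fun σ hσ ↦
    mem_Icc.mpr
      ⟨card_colorFinset_verts_pos (mem_coloredFacets.mp hσ).1, card_colorFinset_verts_le κ σ⟩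
  rw [← sum_fiberwise_of_maps_to hmem]
  refine sum_congr rfl fun c _ ↦ ?_
  rw [facetSeries_eq_sum, mul_sum]
  exact sum_congr rfl fun σ hσ ↦ by rw [(mem_filter.mp hσ).2]

theorem coeff_mul_mk_one {R : Type*} [Semiring R] (φ : R⟦X⟧) (n : ℕ) :
    coeff n (φ * PowerSeries.mk 1) = ∑ i ∈ range (n + 1), coeff i φ := by
  rw [coeff_mul, Nat.sum_antidiagonal_eq_sum_range_succ fun i j ↦ coeff i φ * coeff j _]
  simp

theorem coeff_mul_mk_one_sq {R : Type*} [CommRing R] (φ : R⟦X⟧) (n : ℕ) :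
    coeff n (φ * PowerSeries.mk 1 ^ 2) = ∑ i ∈ range (n + 1), ((n : R) - i + 1) * coeff i φ := by
  rw [mk_one_pow_eq_mk_choose_add R 1, coeff_mul,
    Nat.sum_antidiagonal_eq_sum_range_succ fun i j ↦ coeff i φ * coeff j _]
  refine sum_congr rfl fun i hi ↦ ?_
  rw [coeff_mk, Nat.choose_one_right, Nat.cast_add, Nat.cast_sub (mem_range_succ_iff.mp hi)]
  push_cast
  ring

theorem two_mul_coeff_mk_one_cube {R : Type*} [CommRing R] (n : ℕ) :
    2 * coeff n (PowerSeries.mk 1 ^ 3 : R⟦X⟧) = ((n : R) + 1) * (n + 2) := by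
  have hchoose : 2 * (2 + n).choose 2 = (n + 1) * (n + 2) := by
    rw [mul_comm, add_comm 2 n, Nat.choose_two_right,
      Nat.div_mul_cancel (Nat.even_mul_pred_self _).two_dvd, mul_comm]
    rfl
  rw [mk_one_pow_eq_mk_choose_add R 2, coeff_mk]
  exact_mod_cast congrArg (Nat.cast (R := R)) hchoose

end FacetSeries

section ColoredRelation

open PowerSeries

variable {K : Type*} {S : Finset (EuclideanSpace ℝ (Fin 3))}

/-- A sample with at least two colors contains at least two points, so its hull has
`2 * #vertices - 4` facets. The remaining samples have weights divisible by the given power. -/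
theorem X_pow_dvd_sum_facetSeries_sub (hconv : InConvexPosition S) (hgen : InGeneralPosition S)
    (κ : S → K) : X ^ ((Set.range κ).ncard - 1) ∣
      ∑ c ∈ Icc 1 3, (1 - X) ^ c * facetSeries κ c - (2 * (#S : ℤ⟦X⟧) * (1 - X) - 4) := by
  set U := colorFinset κ Set.univ
  have hU : (Set.range κ).ncard = #U := by
    rw [card_colorFinset]
    simp [colorsOf, Set.range]
  have hpq : (1 - X) + X = (1 : ℤ⟦X⟧) := sub_add_cancel 1 X
  have hone : ∑ R ∈ U.powerset, (1 - X) ^ #R * X ^ (#U - #R) = (1 : ℤ⟦X⟧) := by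
    rw [sum_pow_mul_eq_add_pow, hpq, one_pow]
  have hsum : ∑ c ∈ Icc 1 3, (1 - X) ^ c * facetSeries κ c - (2 * (#S : ℤ⟦X⟧) * (1 - X) - 4) =
      ∑ R ∈ U.powerset, (1 - X) ^ #R * X ^ (#U - #R) *
        (((facets (pointsWithColor κ R) 0).ncard : ℤ⟦X⟧) + 4 -
          2 * (#(pointsWithColor κ R) : ℤ⟦X⟧)) := by
    rw [sum_one_sub_X_pow_mul_facetSeries, ← sum_mul_ncard_facets_pointsWithColor hpq]
    simp only [mul_sub, mul_add, sum_sub_distrib, sum_add_distrib, ← sum_mul,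
      mul_left_comm _ (2 : ℤ⟦X⟧), ← mul_sum]
    linear_combination -4 * hone + 2 * sum_mul_card_pointsWithColor hpq κ
  rw [hU, hsum]
  refine dvd_sum fun R hR ↦ ?_
  rcases le_or_gt 2 #R with htwo | hlt
  · have hle := htwo.trans (card_le_card_pointsWithColor (mem_powerset.mp hR))
    have hsub := pointsWithColor_subset κ R
    have hcount := ncard_facets_zero_add_four (hconv.mono hsub) (hgen.mono hsub) hle
    have hzero : ((facets (pointsWithColor κ R) 0).ncard + 4 : ℤ⟦X⟧) =
        2 * #(pointsWithColor κ R) := mod_cast congrArg (Nat.cast (R := ℤ⟦X⟧)) hcount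
    rw [hzero, sub_self, mul_zero]
    exact dvd_zero _
  · exact ((pow_dvd_pow X (by lia)).mul_left _).mul_right _

theorem colored_facet_relation (hconv : InConvexPosition S) (hgen : InGeneralPosition S)
    {κ : S → K} {j : ℕ} (hj : j + 2 ≤ (Set.range κ).ncard) :
    (e κ 3 j : ℤ) + ∑ i ∈ range (j + 1), (e κ 2 i : ℤ) +
        ∑ i ∈ range (j + 1), ((j : ℤ) - i + 1) * (e κ 1 i : ℤ) =
      2 * ((j : ℤ) + 1) * ((#S : ℤ) - j - 2) := by
  have hinv : (1 - X : ℤ⟦X⟧) * PowerSeries.mk 1 = 1 := by rw [mul_comm, mk_one_mul_one_sub_eq_one]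
  have hcancel : (∑ c ∈ Icc 1 3, (1 - X) ^ c * facetSeries κ c - (2 * (#S : ℤ⟦X⟧) * (1 - X) - 4)) *
      PowerSeries.mk 1 ^ 3 = facetSeries κ 3 + facetSeries κ 2 * PowerSeries.mk 1 +
        facetSeries κ 1 * PowerSeries.mk 1 ^ 2 -
        (C (2 * #S : ℤ) * PowerSeries.mk 1 ^ 2 - C (4 : ℤ) * PowerSeries.mk 1 ^ 3) := by
    have hIcc : Icc 1 3 = {1, 2, 3} := rfl
    simp only [hIcc, sum_insert, sum_singleton, mem_insert, mem_singleton, map_mul, map_natCast,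
      map_ofNat, OfNat.one_ne_ofNat, Nat.reduceEqDiff, or_self, not_false_eq_true]
    generalize (PowerSeries.mk 1 : ℤ⟦X⟧) = M at hinv ⊢
    linear_combination (facetSeries κ 1 * M ^ 2 + facetSeries κ 2 * M * ((1 - X) * M + 1) +
      facetSeries κ 3 * (((1 - X) * M) ^ 2 + (1 - X) * M + 1) - 2 * #S * M ^ 2) * hinv
  have hcoeff := X_pow_dvd_iff.mp
    ((X_pow_dvd_sum_facetSeries_sub hconv hgen κ).mul_right (PowerSeries.mk 1 ^ 3)) j
      (Nat.lt_sub_of_add_lt hj)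
  have hsq : coeff j (PowerSeries.mk 1 ^ 2 : ℤ⟦X⟧) = j + 1 := by
    simp [mk_one_pow_eq_mk_choose_add ℤ 1, add_comm]
  have hcube := two_mul_coeff_mk_one_cube (R := ℤ) j
  rw [hcancel] at hcoeff
  simp only [map_sub, map_add, coeff_C_mul, hsq] at hcoeff
  simp only [coeff_mul_mk_one, coeff_mul_mk_one_sq, facetSeries, coeff_mk] at hcoeff
  linear_combination hcoeff - 2 * hcube

end ColoredRelation

section InjectiveColoring

variable {d : ℕ} {K : Type*} {S : Finset (EuclideanSpace ℝ (Fin d))} {κ : S → K}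
  {σ : OrientedSimplex d}

theorem ncard_colorsOf_of_injective (hκ : Function.Injective κ)
    (A : Set (EuclideanSpace ℝ (Fin d))) : (colorsOf κ A).ncard = {s | s ∈ S ∧ s ∈ A}.ncard := by
  have himage : {s | s ∈ S ∧ s ∈ A} = Subtype.val '' (Subtype.val ⁻¹' A : Set S) := by
    ext x
    simp [and_comm]
  rw [himage, Set.ncard_image_of_injective _ Subtype.val_injective,
    ← Set.ncard_image_of_injective _ hκ]
  rfl

theorem disjoint_colorsOf_of_injective (hκ : Function.Injective κ) (σ : OrientedSimplex d) :
    Disjoint (colorsOf κ σ.posSide) (colorsOf κ (σ.verts : Set (EuclideanSpace ℝ (Fin d)))) := by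
  rw [Set.disjoint_left]
  rintro _ ⟨s, hs, rfl⟩ ⟨t, ht, hts⟩
  exact OrientedSimplex.notMem_posSide ht (hκ hts ▸ hs)

theorem ncard_colorsOf_verts_of_injective (hκ : Function.Injective κ) (hσ : σ.verts ⊆ S) :
    (colorsOf κ (σ.verts : Set (EuclideanSpace ℝ (Fin d)))).ncard = d := by
  have hverts : {s | s ∈ S ∧ s ∈ (σ.verts : Set _)} = σ.verts :=
    Set.ext fun _ ↦ and_iff_right_of_imp fun hx ↦ hσ hx
  rw [ncard_colorsOf_of_injective hκ, hverts, Set.ncard_coe_finset, σ.card_verts]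

theorem chromaticFacets_eq_facets (hκ : Function.Injective κ) (j : ℕ) :
    chromaticFacets κ d j = facets S j := by
  ext σ
  simp only [chromaticFacets, facets, Set.mem_ofPred_eq]
  refine and_congr_right fun hσ ↦ ?_
  simp [disjoint_colorsOf_of_injective hκ, ncard_colorsOf_verts_of_injective hκ hσ,
    ncard_colorsOf_of_injective hκ σ.posSide]

theorem e_eq_ite (hκ : Function.Injective κ) (c j : ℕ) :
    e κ c j = if c = d then (facets S j).ncard else 0 := by
  split_ifs with hc
  · rw [hc, e, chromaticFacets_eq_facets hκ]
  · have hempty : chromaticFacets κ c j = ∅ := Set.eq_empty_of_forall_notMem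
      fun σ ⟨hσ, _, _, hσc⟩ ↦ hc (hσc.symm.trans (ncard_colorsOf_verts_of_injective hκ hσ))
    rw [e, hempty, Set.ncard_empty]

end InjectiveColoring

end ColoredFacets

theorem mainTheorem8_general {K : Type*} (S : Finset (EuclideanSpace ℝ (Fin 3)))
    (hconv : ColoredFacets.InConvexPosition S) (hgen : ColoredFacets.InGeneralPosition S)
    (κ : S → K) (j : ℕ) (hj : j + 2 ≤ (Set.range κ).ncard) :
    ((ColoredFacets.e κ 3 j : ℤ)
        + ∑ i ∈ Finset.range (j + 1), (ColoredFacets.e κ 2 i : ℤ)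
        + ∑ i ∈ Finset.range (j + 1), ((j : ℤ) - i + 1) * (ColoredFacets.e κ 1 i : ℤ)
      = 2 * ((j : ℤ) + 1) * ((S.card : ℤ) - j - 2)) ∧
    (Function.Injective κ →
      ∑ c ∈ Finset.Icc 1 3, (ColoredFacets.e κ c j : ℤ)
          = 2 * ((j : ℤ) + 1) * ((S.card : ℤ) - j - 2) ∧
      ((ColoredFacets.facets S j).ncard : ℤ) = 2 * ((j : ℤ) + 1) * ((S.card : ℤ) - j - 2)) := by
  have hrel := ColoredFacets.colored_facet_relation hconv hgen hj
  refine ⟨hrel, fun hκ ↦ ?_⟩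
  simp only [ColoredFacets.e_eq_ite hκ] at hrel ⊢
  have hfacets : ((ColoredFacets.facets S j).ncard : ℤ) =
      2 * ((j : ℤ) + 1) * ((S.card : ℤ) - j - 2) := by simpa using hrel
  exact ⟨by simpa using hfacets, hfacets⟩

theorem mainTheorem8 (n m : ℕ) (S : Finset (EuclideanSpace ℝ (Fin 3))) (hn : S.card = n)
    (hconv : ColoredFacets.InConvexPosition S) (hgen : ColoredFacets.InGeneralPosition S)
    (κ : S → Fin m) (hκ : Function.Surjective κ) (j : ℕ) (hj : j + 2 ≤ m) :
    ((ColoredFacets.e κ 3 j : ℤ)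
        + ∑ i ∈ Finset.range (j + 1), (ColoredFacets.e κ 2 i : ℤ)
        + ∑ i ∈ Finset.range (j + 1), ((j : ℤ) - i + 1) * (ColoredFacets.e κ 1 i : ℤ)
      = 2 * ((j : ℤ) + 1) * ((n : ℤ) - j - 2)) ∧
    (m = n →
      ∑ c ∈ Finset.Icc 1 3, (ColoredFacets.e κ c j : ℤ)
          = 2 * ((j : ℤ) + 1) * ((n : ℤ) - j - 2) ∧
      ((ColoredFacets.facets S j).ncard : ℤ) = 2 * ((j : ℤ) + 1) * ((n : ℤ) - j - 2)) := by
  subst hn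
  have hrange : (Set.range κ).ncard = m := by simp [hκ.range_eq]
  obtain ⟨hrel, hinj⟩ := mainTheorem8_general S hconv hgen κ j (hj.trans_eq hrange.symm)
  exact ⟨hrel, fun hm ↦ hinj
    ((Fintype.bijective_iff_surjective_and_card κ).mpr ⟨hκ, by simp [hm]⟩).injective⟩
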